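/- Let $R$ be a GCD domain, let $n\ge 0$, and let $K_n$ be the complete graph on the vertices $v_1,\dots,v_n$, with an edge labeling $\alpha$ that assigns to every edge $uv$ an element $l_{uv}\in R$. Let $$R_{(K_n,\alpha)}=\{F=(F(v_1),\dots,F(v_n))\in R^n : l_{uv}\mid F(u)-F(v)\text{ for every edge }uv\}$$ be the $R$-module of generalized splines. For $1\le i\le n$, a zero trail of $v_i$ is a walk without repeated edge that starts at $v_i$ and ends at some $v_j$ with $j<i$. Let $\mathscr L_i$ be the least common multiple, over all zero trails of $v_i$, of the greatest common divisor of the edge labels on the trail (so $\mathscr L_1=1$), and put $Q_{K_n}=\prod_{i=1}^n\mathscr L_i$ (well defined up to a unit). For $F_1,\dots,F_n\in R_{(K_n,\alpha)}$ let $|F_1\ F_2\ \cdots\ F_n|$ be the determinant of the $n\times n$ matrix whose columns are $F_1,\dots,F_n$, with rows from top to bottom the values at $v_n,\dots,v_1$. Then: (a) If $\{F_1,\dots,F_n\}$ is a basis of $R_{(K_n,\alpha)}$ over $R$, then $|F_1\ F_2\ \cdots\ F_n|=r\cdot Q_{K_n}$ for some unit $r\in R$. (b) If all edge labels are non-zero,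 then $\{F_1,\dots,F_n\}$ is a basis of $R_{(K_n,\alpha)}$ over $R$ if and only if $|F_1\ F_2\ \cdots\ F_n|=r\cdot Q_{K_n}$ for some unit $r\in R$. -/

import Mathlib

namespace GSpline

/-- The module `R_(G,α)` of generalized splines on a graph `G` with vertices
`v_1, …, v_n` (indexed by `Fin n`), where the edge `e` carries the principal ideal
generated by `α e`: vertex labelings `F` with `F u - F v ∈ (α (uv))` for every edge `uv`. -/
def splineModule {R : Type*} [CommRing R] {n : ℕ} (G : SimpleGraph (Fin n))
    (α : G.edgeSet → R) : Submodule R (Fin n → R) where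
  carrier := {F | ∀ (u v : Fin n) (h : G.Adj u v),
    F u - F v ∈ Ideal.span {α ⟨s(u, v), G.mem_edgeSet.mpr h⟩}}
  zero_mem' := by
    intro u v h
    simp
  add_mem' := by
    intro F F' hF hF' u v h
    have key := Ideal.add_mem _ (hF u v h) (hF' u v h)
    rwa [sub_add_sub_comm] at key
  smul_mem' := by
    intro c F hF u v h
    have key := Ideal.mul_mem_left _ c (hF u v h)
    rwa [mul_sub] at key

/-- The gcd of the edge labels on a walk. -/
def labelGCD {R : Type*} [CommRing R] [NormalizedGCDMonoid R] {n : ℕ}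
    {G : SimpleGraph (Fin n)} (α : G.edgeSet → R) {u v : Fin n} (p : G.Walk u v) : R :=
  (p.edges.attach.map fun e => α ⟨e.1, p.edges_subset_edgeSet e.2⟩ : Multiset R).gcd

/-- The zero trails of the vertex `i`: walks without repeated edge which start at `i` and
end at a vertex `j` of smaller index. -/
def ZeroTrail {n : ℕ} (G : SimpleGraph (Fin n)) (i : Fin n) : Type :=
  Σ j : {j : Fin n // j < i}, {p : G.Walk i j.1 // p.IsTrail}

instance finite_trail {n : ℕ} (G : SimpleGraph (Fin n)) (u v : Fin n) :
    Finite {p : G.Walk u v // p.IsTrail} := by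
  classical
  refine Set.Finite.subset
    (G.finsetWalkLengthLT (G.edgeFinset.card + 1) u v).finite_toSet ?_
  intro p hp
  rw [Finset.mem_coe, SimpleGraph.mem_finsetWalkLengthLT_iff]
  exact Nat.lt_succ_of_le hp.length_le_card_edgeFinset

instance finite_zeroTrail {n : ℕ} (G : SimpleGraph (Fin n)) (i : Fin n) :
    Finite (ZeroTrail G i) :=
  inferInstanceAs (Finite (Σ j : {j : Fin n // j < i}, {p : G.Walk i j.1 // p.IsTrail}))

noncomputable instance fintype_zeroTrail {n : ℕ} (G : SimpleGraph (Fin n)) (i : Fin n) :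
    Fintype (ZeroTrail G i) :=
  Fintype.ofFinite _

/-- The element `L_i`: the least common multiple, over all zero trails of `v_i`, of the gcd of
the edge labels on the trail. The first vertex has no zero trail, so that `L_1 = 1`. -/
noncomputable def trailLCM {R : Type*} [CommRing R] [NormalizedGCDMonoid R] {n : ℕ}
    (G : SimpleGraph (Fin n)) (α : G.edgeSet → R) (i : Fin n) : R :=
  Finset.univ.lcm fun t : ZeroTrail G i => labelGCD α t.2.1

/-- `Q_G`, the product of the `L_i`. -/
noncomputable def Q {R : Type*} [CommRing R] [NormalizedGCDMonoid R] {n : ℕ}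
    (G : SimpleGraph (Fin n)) (α : G.edgeSet → R) : R :=
  ∏ i, trailLCM G α i

/-- The spline matrix: its columns are `F_1, …, F_n`, its rows from top to bottom are
the values at `v_n, …, v_1`. -/
def splineMatrix {R : Type*} {n : ℕ} (F : Fin n → Fin n → R) : Matrix (Fin n) (Fin n) R :=
  Matrix.of fun r k => F k r.rev

/-- The family `F_1, …, F_n` of splines is a basis of the `R`-module `R_(G,α)`. -/
def FormsBasis {R : Type*} [CommRing R] {n : ℕ} {G : SimpleGraph (Fin n)} {α : G.edgeSet → R}
    (F : Fin n → splineModule G α) : Prop :=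
  ∃ b : Module.Basis (Fin n) R (splineModule G α), ⇑b = F

end GSpline

/-!
If divisibility in `R` is a total preorder, the gcd of the labels on a trail is one of these
labels, and a max-flow–min-cut argument applies: the vertices reachable from `v_i` along edges
whose labels do not divide `L_i` have indices `≥ i`, and `L_i` times the indicator of this set is
a spline. These splines form a triangular basis of determinant `Q`.

Over a GCD domain no such basis need exist, but a failure of divisibility `x ∣ y` persists in some
localization where divisibility is total: a submonoid `S` maximal subject to `x ∤ s y` for all
`s ∈ S` contains one of any two relatively prime elements. Hence `Q ∣ det F` for all splines
`F_1, …, F_n` and `det F ∣ Q` for all generating ones, which is (a). Conversely, if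
`det F` is a unit multiple of `Q`, it divides the determinants in Cramer's rule for a further
spline, so that this spline is a combination of the `F_i`.
-/

namespace GSpline

open Matrix Submodule

section LocalDivisibility

variable {M : Type*} [CommMonoid M] {S : Submonoid M} {a b c x y : M}

/-- `a` divides `b` in the localization at `S`, expressed without denominators. -/
def DvdLoc (S : Submonoid M) (a b : M) : Prop :=
  ∃ s ∈ S, a ∣ s * b

/-- Divisibility in the localization at `S` is a total relation; for a domain and `0 ∉ S` this says
that the localization is a valuation ring. -/
def DvdTotal (S : Submonoid M) : Prop :=
  ∀ a b : M, DvdLoc S a b ∨ DvdLoc S b a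

theorem DvdLoc.of_dvd (h : a ∣ b) : DvdLoc S a b :=
  ⟨1, S.one_mem, by rwa [one_mul]⟩

theorem DvdLoc.trans (hab : DvdLoc S a b) (hbc : DvdLoc S b c) : DvdLoc S a c := by
  obtain ⟨s, hs, hab⟩ := hab
  obtain ⟨t, ht, hbc⟩ := hbc
  exact ⟨s * t, S.mul_mem hs ht, mul_assoc s t c ▸ hab.trans (mul_dvd_mul_left s hbc)⟩

theorem exists_mem_forall_dvd_mul {ι : Type*} [Finite ι] (S : Submonoid M) (f : ι → M) (y : M) :
    ∃ s ∈ S, ∀ i, DvdLoc S (f i) y → f i ∣ s * y := by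
  classical
  have := Fintype.ofFinite ι
  choose s hsS hs using fun i : {i // DvdLoc S (f i) y} => i.2
  exact ⟨∏ i, s i, S.prod_mem fun i _ => hsS i, fun i hi => (hs ⟨i, hi⟩).trans
    (mul_dvd_mul_right (Finset.dvd_prod_of_mem s (Finset.mem_univ _)) y)⟩

theorem exists_maximal_not_dvdLoc (h : ¬ x ∣ y) :
    ∃ S : Submonoid M, Maximal (fun S => ¬ DvdLoc S x y) S := by
  have hbot : ¬ DvdLoc (⊥ : Submonoid M) x y := by
    rintro ⟨s, hs, hd⟩
    rw [Submonoid.mem_bot] at hs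
    exact h (by rwa [hs, one_mul] at hd)
  have hsSup : ∀ C ⊆ {S : Submonoid M | ¬ DvdLoc S x y}, IsChain (· ≤ ·) C → C.Nonempty →
      ¬ DvdLoc (sSup C) x y := by
    rintro C hC hchain hne ⟨s, hs, hd⟩
    obtain ⟨T, hT, hsT⟩ := (Submonoid.mem_sSup_of_directedOn hne hchain.directedOn).1 hs
    exact hC hT ⟨s, hsT, hd⟩
  obtain ⟨S, -, hS⟩ := zorn_le_nonempty₀ {S : Submonoid M | ¬ DvdLoc S x y}
    (fun C hC hchain T hT => ⟨sSup C, hsSup C hC hchain ⟨T, hT⟩, fun _ => le_sSup⟩) ⊥ hbot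
  exact ⟨S, hS⟩

theorem exists_dvdLoc_pow_mul_of_notMem (hS : Maximal (fun S => ¬ DvdLoc S x y) S) (ha : a ∉ S) :
    ∃ k : ℕ, DvdLoc S x (a ^ k * y) := by
  have hlt : S < S ⊔ Submonoid.powers a :=
    lt_of_le_not_ge le_sup_left fun hle =>
      ha (hle (le_sup_right (a := S) (Submonoid.mem_powers a)))
  obtain ⟨_, ht, hd⟩ := not_not.1 (hS.not_prop_of_gt hlt)
  obtain ⟨s, hs, _, ⟨k, rfl⟩, rfl⟩ := Submonoid.mem_sup.1 ht
  exact ⟨k, s, hs, by rwa [← mul_assoc]⟩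

end LocalDivisibility

section GCDMonoid

variable {M : Type*} [CommMonoidWithZero M] [GCDMonoid M] {S : Submonoid M} {a b c x y : M}

theorem DvdLoc.gcd (ha : DvdLoc S c a) (hb : DvdLoc S c b) : DvdLoc S c (gcd a b) := by
  obtain ⟨s, hs, ha⟩ := ha
  obtain ⟨t, ht, hb⟩ := hb
  have ha' : c ∣ s * t * a := mul_right_comm s t a ▸ ha.mul_right t
  have hb' : c ∣ s * t * b := mul_assoc s t b ▸ hb.mul_left s
  exact ⟨s * t, S.mul_mem hs ht, (dvd_gcd ha' hb').trans (gcd_mul_left' _ _ _).dvd⟩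

theorem mem_or_mem_of_isRelPrime (hS : Maximal (fun S => ¬ DvdLoc S x y) S)
    (hab : IsRelPrime a b) : a ∈ S ∨ b ∈ S := by
  by_contra! hmem
  obtain ⟨k, hk⟩ := exists_dvdLoc_pow_mul_of_notMem hS hmem.1
  obtain ⟨l, hl⟩ := exists_dvdLoc_pow_mul_of_notMem hS hmem.2
  have hunit : IsUnit (GCDMonoid.gcd (a ^ k) (b ^ l)) := gcd_isUnit_iff_isRelPrime.2 hab.pow
  have hgcd : GCDMonoid.gcd (a ^ k * y) (b ^ l * y) ∣ y :=
    (gcd_mul_right' y _ _).dvd.trans (hunit.mul_left_dvd.2 dvd_rfl)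
  exact hS.prop ((hk.gcd hl).trans (.of_dvd hgcd))

theorem dvdTotal_of_maximal (hS : Maximal (fun S => ¬ DvdLoc S x y) S) : DvdTotal S := by
  intro a b
  obtain ⟨a', b', ha, hb, hab⟩ := extract_gcd a b
  have hcross : a' * b = a * b' := by
    rw [hb, mul_left_comm, ← mul_assoc, ← ha]
  refine (mem_or_mem_of_isRelPrime hS (gcd_isUnit_iff_isRelPrime.1 hab)).imp
    (fun h => ⟨a', h, b', hcross⟩) (fun h => ⟨b', h, a', ?_⟩)
  rw [mul_comm b' a, ← hcross, mul_comm]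

theorem dvd_of_forall_dvdTotal (h : ∀ S : Submonoid M, DvdTotal S → DvdLoc S x y) : x ∣ y := by
  by_contra hxy
  obtain ⟨S, hS⟩ := exists_maximal_not_dvdLoc hxy
  exact hS.prop (h S (dvdTotal_of_maximal hS))

end GCDMonoid

theorem DvdTotal.exists_mem_dvdLoc_gcd {M : Type*} [CommMonoidWithZero M] [NormalizedGCDMonoid M]
    {S : Submonoid M} (hS : DvdTotal S) {m : Multiset M} (hm : m ≠ 0) :
    ∃ a ∈ m, DvdLoc S a m.gcd := by
  induction m using Multiset.induction_on with
  | empty => exact absurd rfl hm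
  | cons a m ih =>
    rcases eq_or_ne m 0 with rfl | hm0
    · exact ⟨a, Multiset.mem_cons_self a 0, .of_dvd (by simp)⟩
    obtain ⟨b, hb, hbm⟩ := ih hm0
    rw [Multiset.gcd_cons]
    rcases hS a m.gcd with h | h
    · exact ⟨a, Multiset.mem_cons_self a m, .gcd (.of_dvd dvd_rfl) h⟩
    · exact ⟨b, Multiset.mem_cons_of_mem hb, hbm.trans (.gcd h (.of_dvd dvd_rfl))⟩

section Determinant

variable {R ι : Type*} [CommRing R] [Fintype ι] [DecidableEq ι] {A B : Matrix ι ι R}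

theorem det_dvd_det_of_row_mem_span (h : ∀ i, A.row i ∈ span R (Set.range B.row)) :
    B.det ∣ A.det := by
  simp only [mem_span_range_iff_exists_fun] at h
  choose c hc using h
  have hmul : A = of c * B := by
    ext i j
    simpa [Matrix.mul_apply] using (congrFun (hc i) j).symm
  exact ⟨(of c).det, by rw [mul_comm, ← det_mul, ← hmul]⟩

theorem linearIndependent_row_of_det_mem_nonZeroDivisors (hA : A.det ∈ nonZeroDivisors R) :
    LinearIndependent R A.row :=
  vecMul_injective_iff.1 <| (injective_iff_map_eq_zero A.vecMulLinear).2 fun _ hv =>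
    eq_zero_of_det_mem_nonZeroDivisors_of_vecMul_eq_zero hA hv

theorem mem_span_row_of_det_dvd_det_updateRow (hA : A.det ∈ nonZeroDivisors R) {v : ι → R}
    (h : ∀ i, A.det ∣ (A.updateRow i v).det) : v ∈ span R (Set.range A.row) := by
  choose c hc using h
  have hcramer : cramer Aᵀ v = A.det • c := funext fun i => by
    rw [cramer_transpose_apply, hc, Pi.smul_apply, smul_eq_mul]
  have hsmul : A.det • (c ᵥ* A) = A.det • v := by
    rw [← mulVec_transpose, ← mulVec_smul, ← hcramer, mulVec_cramer, det_transpose]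
  have hv : c ᵥ* A = v := funext fun j =>
    (mul_cancel_left_mem_nonZeroDivisors hA).1 (congrFun hsmul j)
  exact (mem_span_range_iff_exists_fun R).2 ⟨c, by rw [← hv, vecMul_eq_sum]; rfl⟩

end Determinant

section Spline

variable {R : Type*} [CommRing R] {n : ℕ} {G : SimpleGraph (Fin n)} {α : G.edgeSet → R}

theorem mem_splineModule {F : Fin n → R} : F ∈ splineModule G α ↔
    ∀ (u v : Fin n) (h : G.Adj u v), α ⟨s(u, v), G.mem_edgeSet.mpr h⟩ ∣ F u - F v := by
  simp only [← Ideal.mem_span_singleton]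
  rfl

theorem dvd_sub_of_forall_mem_edges {F : Fin n → R} (hF : F ∈ splineModule G α) {g : R}
    {u v : Fin n} (p : G.Walk u v)
    (hp : ∀ e (he : e ∈ p.edges), g ∣ α ⟨e, p.edges_subset_edgeSet he⟩) : g ∣ F u - F v := by
  induction p with
  | nil => simp
  | @cons u v w h p ih =>
    rw [← sub_add_sub_cancel (F u) (F v)]
    exact dvd_add ((hp s(u, v) (by simp)).trans (mem_splineModule.1 hF u v h))
      (ih fun e he => hp e (by simp [he]))

theorem indicator_mem_splineModule {B : Set (Fin n)} {c : R}
    (hB : ∀ (u v : Fin n) (h : G.Adj u v), u ∈ B → v ∉ B →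
      α ⟨s(u, v), G.mem_edgeSet.mpr h⟩ ∣ c) :
    (B.indicator fun _ => c) ∈ splineModule G α := by
  refine mem_splineModule.2 fun u v h => ?_
  by_cases hu : u ∈ B <;> by_cases hv : v ∈ B
  · simp [hu, hv]
  · simpa [hu, hv] using hB u v h hu hv
  · simpa [hu, hv, Sym2.eq_swap (a := u)] using hB v u h.symm hv hu
  · simp [hu, hv]

theorem formsBasis_iff {F : Fin n → splineModule G α} :
    FormsBasis F ↔ LinearIndependent R (fun k => (F k : Fin n → R)) ∧
      splineModule G α ≤ span R (Set.range fun k => (F k : Fin n → R)) := by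
  have hspan : span R (Set.range fun k => (F k : Fin n → R)) =
      (span R (Set.range F)).map (splineModule G α).subtype := by
    rw [map_span, ← Set.range_comp]
    rfl
  rw [hspan]
  constructor
  · rintro ⟨b, rfl⟩
    refine ⟨b.linearIndependent.map' _ (ker_subtype _), ?_⟩
    rw [b.span_eq, map_subtype_top]
  · rintro ⟨hli, hle⟩
    have htop : ⊤ ≤ span R (Set.range F) := by
      rwa [← map_le_map_iff_of_injective (splineModule G α).injective_subtype, map_subtype_top]
    have hliF : LinearIndependent R F := .of_comp (splineModule G α).subtype hli
    exact ⟨.mk hliF htop, Module.Basis.coe_mk hliF htop⟩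

theorem associated_det_splineMatrix (F : Fin n → Fin n → R) :
    Associated (splineMatrix F).det (of F).det := by
  have hperm : splineMatrix F = (of F)ᵀ.submatrix Fin.revPerm id := rfl
  rw [hperm, det_permute, det_transpose]
  exact associated_unit_mul_left _ _ ((Equiv.Perm.sign _).isUnit.map (Int.castRingHom R))

/-- The subgraph of those edges whose labels do not divide `y` in the localization at `S`; its
connected components are the supports of splines with values in `{0, s * y}` for some `s ∈ S`. -/
def nonDividingSubgraph (S : Submonoid R) (α : G.edgeSet → R) (y : R) : SimpleGraph (Fin n) :=
  SimpleGraph.fromEdgeSet {e | ∃ he : e ∈ G.edgeSet, ¬ DvdLoc S (α ⟨e, he⟩) y}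

variable [NormalizedGCDMonoid R] {S : Submonoid R}

theorem labelGCD_dvd {u v : Fin n} (p : G.Walk u v) {e : Sym2 (Fin n)} (he : e ∈ p.edges) :
    labelGCD α p ∣ α ⟨e, p.edges_subset_edgeSet he⟩ :=
  Multiset.gcd_dvd (Multiset.mem_coe.2 (List.mem_map.2 ⟨⟨e, he⟩, List.mem_attach _ _, rfl⟩))

theorem labelGCD_dvd_trailLCM {i j : Fin n} (hj : j < i) {p : G.Walk i j} (hp : p.IsTrail) :
    labelGCD α p ∣ trailLCM G α i :=
  Finset.dvd_lcm (f := fun t : ZeroTrail G i => labelGCD α t.2.1)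
    (b := ⟨⟨j, hj⟩, ⟨p, hp⟩⟩) (Finset.mem_univ _)

theorem trailLCM_dvd_apply {F : Fin n → R} (hF : F ∈ splineModule G α) {i : Fin n}
    (hi : ∀ j < i, F j = 0) : trailLCM G α i ∣ F i := by
  refine Finset.lcm_dvd fun t _ => ?_
  have hsub := dvd_sub_of_forall_mem_edges hF t.2.1 fun e he => labelGCD_dvd t.2.1 he
  rwa [hi _ t.1.2, sub_zero] at hsub

theorem labelGCD_mem_nonZeroDivisors (hα : ∀ e, α e ≠ 0) {u v : Fin n} (huv : u ≠ v)
    (p : G.Walk u v) : labelGCD α p ∈ nonZeroDivisors R := by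
  obtain ⟨e, he⟩ := List.exists_mem_of_ne_nil p.edges fun h => huv (p.edges_eq_nil.1 h).eq
  obtain ⟨c, hc⟩ := labelGCD_dvd (α := α) p he
  exact (mul_mem_nonZeroDivisors.1 (hc ▸ mem_nonZeroDivisors_of_ne_zero (hα ⟨e, _⟩))).1

theorem Q_mem_nonZeroDivisors (hα : ∀ e, α e ≠ 0) : Q G α ∈ nonZeroDivisors R := by
  refine prod_mem fun i _ => ?_
  obtain ⟨c, hc⟩ := Finset.lcm_dvd_prod Finset.univ fun t : ZeroTrail G i => labelGCD α t.2.1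
  have hprod : ∏ t : ZeroTrail G i, labelGCD α t.2.1 ∈ nonZeroDivisors R :=
    prod_mem fun t _ => labelGCD_mem_nonZeroDivisors hα t.1.2.ne' t.2.1
  exact (mul_mem_nonZeroDivisors.1 (hc ▸ hprod)).1

theorem DvdTotal.exists_mem_edges_dvdLoc_labelGCD (hS : DvdTotal S) (α : G.edgeSet → R)
    {u v : Fin n} (huv : u ≠ v) (p : G.Walk u v) :
    ∃ e, ∃ he : e ∈ p.edges, DvdLoc S (α ⟨e, p.edges_subset_edgeSet he⟩) (labelGCD α p) := by
  have hne : p.edges ≠ [] := fun h => huv (p.edges_eq_nil.1 h).eq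
  obtain ⟨_, ha, hd⟩ := hS.exists_mem_dvdLoc_gcd
    (m := (p.edges.attach.map fun e => α ⟨e.1, p.edges_subset_edgeSet e.2⟩ : Multiset R))
    (by simpa using hne)
  obtain ⟨⟨e, he⟩, -, rfl⟩ := List.mem_map.1 (Multiset.mem_coe.1 ha)
  exact ⟨e, he, hd⟩

theorem DvdTotal.exists_mem_edges_dvdLoc_trailLCM (hS : DvdTotal S) (α : G.edgeSet → R)
    {i j : Fin n} (hj : j < i) (p : G.Walk i j) :
    ∃ e, ∃ he : e ∈ p.edges, DvdLoc S (α ⟨e, p.edges_subset_edgeSet he⟩) (trailLCM G α i) := by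
  classical
  obtain ⟨e, he, hd⟩ := hS.exists_mem_edges_dvdLoc_labelGCD α hj.ne' (p.toPath : G.Walk i j)
  exact ⟨e, p.edges_toPath_subset_edges he,
    hd.trans (.of_dvd (labelGCD_dvd_trailLCM hj p.toPath.2.isTrail))⟩

theorem DvdTotal.not_reachable_nonDividingSubgraph (hS : DvdTotal S) {i j : Fin n} (hj : j < i) :
    ¬ (nonDividingSubgraph S α (trailLCM G α i)).Reachable i j := by
  rintro ⟨p⟩
  have hle : nonDividingSubgraph S α (trailLCM G α i) ≤ G := fun u v h =>
    ((SimpleGraph.fromEdgeSet_adj _).1 h).1.1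
  obtain ⟨e, he, hd⟩ := hS.exists_mem_edges_dvdLoc_trailLCM α hj (p.mapLe hle)
  rw [SimpleGraph.Walk.edges_mapLe_eq_edges] at he
  have hmem := p.edges_subset_edgeSet he
  rw [nonDividingSubgraph, SimpleGraph.edgeSet_fromEdgeSet] at hmem
  exact hmem.1.2 hd

/-- A flow-up family of splines over the localization at `S`, with denominators cleared: `H i`
vanishes before `v_i`, and its value at `v_i` is the smallest possible one, `L_i`, up to a factor
from `S`. -/
structure IsLocalFlowUp (S : Submonoid R) (G : SimpleGraph (Fin n)) (α : G.edgeSet → R)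
    (H : Fin n → Fin n → R) : Prop where
  mem : ∀ i, H i ∈ splineModule G α
  apply_eq_zero : ∀ i, ∀ j < i, H i j = 0
  exists_apply_self_eq : ∀ i, ∃ s ∈ S, H i i = s * trailLCM G α i

theorem DvdTotal.exists_isLocalFlowUp (hS : DvdTotal S) (G : SimpleGraph (Fin n))
    (α : G.edgeSet → R) : ∃ H, IsLocalFlowUp S G α H := by
  choose s hsS hs using fun i => exists_mem_forall_dvd_mul S α (trailLCM G α i)
  let B : Fin n → Set (Fin n) := fun i =>
    {v | (nonDividingSubgraph S α (trailLCM G α i)).Reachable i v}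
  have hi : ∀ i, i ∈ B i := fun i => SimpleGraph.Reachable.refl i
  have hlt : ∀ i, ∀ j < i, j ∉ B i := fun i j hj => hS.not_reachable_nonDividingSubgraph hj
  refine ⟨fun i => (B i).indicator fun _ => s i * trailLCM G α i, fun i => ?_,
    fun i j hj => Set.indicator_of_notMem (hlt i j hj) _,
    fun i => ⟨s i, hsS i, Set.indicator_of_mem (hi i) _⟩⟩
  refine indicator_mem_splineModule fun u v h hu hv => hs i _ ?_
  by_contra hd
  have hadj : (nonDividingSubgraph S α (trailLCM G α i)).Adj u v :=
    (SimpleGraph.fromEdgeSet_adj _).2 ⟨⟨G.mem_edgeSet.2 h, hd⟩, h.ne⟩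
  exact hv (hu.trans hadj.reachable)

namespace IsLocalFlowUp

variable {H : Fin n → Fin n → R}

theorem exists_det_eq (hH : IsLocalFlowUp S G α H) : ∃ s ∈ S, (of H).det = s * Q G α := by
  choose s hsS hs using hH.exists_apply_self_eq
  refine ⟨∏ i, s i, S.prod_mem fun i _ => hsS i, ?_⟩
  rw [det_of_isUpperTriangular (M := of H) fun i j hij => hH.apply_eq_zero i j hij, Q,
    ← Finset.prod_mul_distrib]
  exact Finset.prod_congr rfl fun i _ => hs i

theorem exists_smul_sub_smul_apply_eq_zero (hH : IsLocalFlowUp S G α H) {F : Fin n → R}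
    (hF : F ∈ splineModule G α) {i : Fin n} (hi : ∀ j < i, F j = 0) :
    ∃ s ∈ S, ∃ q : R, ∀ j ≤ i, (s • F - q • H i) j = 0 := by
  obtain ⟨s, hsS, hs⟩ := hH.exists_apply_self_eq i
  obtain ⟨q, hq⟩ := trailLCM_dvd_apply hF hi
  refine ⟨s, hsS, q, fun j hj => ?_⟩
  simp only [Pi.sub_apply, Pi.smul_apply, smul_eq_mul]
  rcases hj.lt_or_eq with hj | rfl
  · rw [hi j hj, hH.apply_eq_zero i j hj]
    ring
  · rw [hs, hq]
    ring

theorem exists_smul_mem_span_of_forall_lt (hH : IsLocalFlowUp S G α H) {m : ℕ} (hm : m ≤ n)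
    {F : Fin n → R} (hF : F ∈ splineModule G α) (h0 : ∀ j : Fin n, j.1 < m → F j = 0) :
    ∃ t ∈ S, t • F ∈ span R (Set.range H) := by
  induction hm using Nat.decreasingInduction generalizing F with
  | self =>
    obtain rfl : F = 0 := funext fun j => h0 j j.2
    exact ⟨1, S.one_mem, by simp⟩
  | of_succ m hm ih =>
    obtain ⟨s, hs, q, hq⟩ := hH.exists_smul_sub_smul_apply_eq_zero hF (i := ⟨m, hm⟩) h0
    obtain ⟨t, ht, hmem⟩ := ih
      (sub_mem (smul_mem _ s hF) (smul_mem _ q (hH.mem ⟨m, hm⟩)))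
      fun j hj => hq j (Nat.le_of_lt_succ hj)
    refine ⟨t * s, S.mul_mem ht hs, ?_⟩
    have hsplit : (t * s) • F = t • (s • F - q • H ⟨m, hm⟩) + (t * q) • H ⟨m, hm⟩ := by
      module
    rw [hsplit]
    exact add_mem hmem (smul_mem _ _ (subset_span ⟨_, rfl⟩))

theorem exists_smul_mem_span (hH : IsLocalFlowUp S G α H) {F : Fin n → R}
    (hF : F ∈ splineModule G α) : ∃ t ∈ S, t • F ∈ span R (Set.range H) :=
  hH.exists_smul_mem_span_of_forall_lt n.zero_le hF fun j hj => absurd hj j.1.not_lt_zero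

end IsLocalFlowUp

theorem Q_dvd_det {F : Fin n → Fin n → R} (hF : ∀ i, F i ∈ splineModule G α) :
    Q G α ∣ (of F).det := by
  refine dvd_of_forall_dvdTotal fun S hS => ?_
  obtain ⟨H, hH⟩ := hS.exists_isLocalFlowUp G α
  obtain ⟨s, -, hs⟩ := hH.exists_det_eq
  choose t htS ht using fun i => hH.exists_smul_mem_span (hF i)
  refine ⟨∏ i, t i, S.prod_mem fun i _ => htS i, ?_⟩
  calc Q G α ∣ (of H).det := Dvd.intro_left s hs.symm
    _ ∣ (of fun i j => t i * of F i j).det := det_dvd_det_of_row_mem_span ht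
    _ = (∏ i, t i) * (of F).det := det_mul_column t (of F)

theorem det_dvd_Q {F : Fin n → Fin n → R}
    (hF : splineModule G α ≤ span R (Set.range F)) : (of F).det ∣ Q G α := by
  refine dvd_of_forall_dvdTotal fun S hS => ?_
  obtain ⟨H, hH⟩ := hS.exists_isLocalFlowUp G α
  obtain ⟨s, hsS, hs⟩ := hH.exists_det_eq
  exact ⟨s, hsS, hs ▸ det_dvd_det_of_row_mem_span fun i => hF (hH.mem i)⟩

theorem FormsBasis.associated_det {F : Fin n → splineModule G α} (hF : FormsBasis F) :
    Associated (of fun k => (F k : Fin n → R)).det (Q G α) :=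
  associated_of_dvd_dvd (det_dvd_Q (formsBasis_iff.1 hF).2) (Q_dvd_det fun k => (F k).2)

theorem det_dvd_det_updateRow {F : Fin n → splineModule G α}
    (h : Associated (of fun k => (F k : Fin n → R)).det (Q G α)) {H : Fin n → R}
    (hH : H ∈ splineModule G α) (i : Fin n) :
    (of fun k => (F k : Fin n → R)).det ∣
      ((of fun k => (F k : Fin n → R)).updateRow i H).det := by
  refine h.dvd.trans (Q_dvd_det (F := updateRow _ i H) fun k => ?_)
  rcases eq_or_ne k i with rfl | hki
  · simpa using hH
  · rw [updateRow_ne hki]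
    exact (F k).2

theorem formsBasis_of_associated_det (hα : ∀ e, α e ≠ 0) {F : Fin n → splineModule G α}
    (h : Associated (of fun k => (F k : Fin n → R)).det (Q G α)) : FormsBasis F := by
  have hdet : (of fun k => (F k : Fin n → R)).det ∈ nonZeroDivisors R := by
    obtain ⟨c, hc⟩ := h.dvd
    exact (mul_mem_nonZeroDivisors.1 (hc ▸ Q_mem_nonZeroDivisors hα)).1
  exact formsBasis_iff.2 ⟨linearIndependent_row_of_det_mem_nonZeroDivisors hdet, fun _ hH =>
    mem_span_row_of_det_dvd_det_updateRow hdet (det_dvd_det_updateRow h hH)⟩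

theorem associated_det_Q_iff (F : Fin n → Fin n → R) :
    Associated (of F).det (Q G α) ↔
      ∃ r : R, IsUnit r ∧ (splineMatrix F).det = r * Q G α := by
  have hs := associated_det_splineMatrix F
  constructor
  · intro h
    obtain ⟨u, hu⟩ := (hs.trans h).symm
    exact ⟨u, u.isUnit, by rw [← hu, mul_comm]⟩
  · rintro ⟨r, hr, h⟩
    exact hs.symm.trans (h ▸ associated_unit_mul_left _ r hr)

end Spline

end GSpline

theorem mainTheorem2_general {R : Type*} [CommRing R] [NormalizedGCDMonoid R] {n : ℕ}
    {G : SimpleGraph (Fin n)} {α : G.edgeSet → R} (F : Fin n → GSpline.splineModule G α) :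
    (GSpline.FormsBasis F →
      ∃ r : R, IsUnit r ∧
        (GSpline.splineMatrix fun k => (F k : Fin n → R)).det = r * GSpline.Q G α) ∧
    ((∀ e, α e ≠ 0) →
      (GSpline.FormsBasis F ↔
        ∃ r : R, IsUnit r ∧
          (GSpline.splineMatrix fun k => (F k : Fin n → R)).det = r * GSpline.Q G α)) := by
  rw [← GSpline.associated_det_Q_iff]
  exact ⟨fun hF => hF.associated_det,
    fun hα => ⟨fun hF => hF.associated_det, GSpline.formsBasis_of_associated_det hα⟩⟩

theorem mainTheorem2 {R : Type*} [CommRing R] [IsDomain R] [NormalizedGCDMonoid R] (n : ℕ)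
    (α : (SimpleGraph.completeGraph (Fin n)).edgeSet → R)
    (F : Fin n → GSpline.splineModule (SimpleGraph.completeGraph (Fin n)) α) :
    (GSpline.FormsBasis F →
      ∃ r : R, IsUnit r ∧
        (GSpline.splineMatrix fun k => (F k : Fin n → R)).det =
          r * GSpline.Q (SimpleGraph.completeGraph (Fin n)) α) ∧
    ((∀ e, α e ≠ 0) →
      (GSpline.FormsBasis F ↔
        ∃ r : R, IsUnit r ∧
          (GSpline.splineMatrix fun k => (F k : Fin n → R)).det =
            r * GSpline.Q (SimpleGraph.completeGraph (Fin n)) α)) :=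
  mainTheorem2_general F
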